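/- Let $p$ be an odd prime and let $m\ge 2$, $n\ge 1$ and $1\le r\le\min\{n,m-1\}$ be integers. Let $G$ be the finite non-abelian split metacyclic $p$-group $$G=\langle x,y : x^{p^m}=1,\ y^{p^n}=1,\ yxy^{-1}=x^{1+p^{m-r}}\rangle .$$ Let $u$ be an integer whose class generates the group of units modulo $p^m$, and let $\alpha,\beta,\delta\in\mathrm{Aut}(G)$ be the automorphisms given by $$\alpha(x)=x^u,\ \alpha(y)=y;\qquad \beta(x)=x,\ \beta(y)=x^{p^{\max\{m-n,0\}}}y;\qquad \delta(x)=x,\ \delta(y)=y^{1+p^r}.$$ Put $\widetilde\alpha=\alpha^{(p-1)p^{m-r-1}}$, $\widetilde\beta=\beta^{p^{\min\{m,n\}-r}}$ and $\widetilde\delta=\delta^{p^{\max\{n-2r,0\}}}$. Then $\widetilde\alpha$ and $\widetilde\delta$ commute and $\langle\widetilde\alpha\rangle\cap\langle\widetilde\delta\rangle=1$, so that $\langle\widetilde\alpha\rangle\langle\widetilde\delta\rangle=\langle\widetilde\alpha\rangle\times\langle\widetilde\delta\rangle$. Let $\Gamma:G\to\mathrm{Aut}(G)$ be any $\mathrm{Aut}(G)$-equivariant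 antihomomorphism, that is, any map with $\Gamma(\sigma\tau)=\Gamma(\tau)\Gamma(\sigma)$ and $\Gamma(\varphi(\sigma))=\varphi\,\Gamma(\sigma)\,\varphi^{-1}$ for all $\sigma,\tau\in G$ and $\varphi\in\mathrm{Aut}(G)$. Then (a) $\Gamma(y)\in\langle\widetilde\alpha\rangle\times\langle\widetilde\delta\rangle$; (b) $\Gamma(x)\in\langle\widetilde\beta\rangle$. Consequently there are integers $a,b,d$ with $\Gamma(x)=\widetilde\beta^{\,b}$ and $\Gamma(y)=\widetilde\alpha^{\,a}\widetilde\delta^{\,d}$, and $\Gamma$ is the only antihomomorphism from $G$ to $\mathrm{Aut}(G)$ with these values at $x$ and $y$; that is, $\Gamma=\Gamma_{a,b,d}$. -/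

import Mathlib

/-- An antihomomorphism from a group to another: `Γ (σ τ) = Γ τ Γ σ`. -/
def IsAntihom {G K : Type*} [Group G] [Group K] (Γ : G → K) : Prop :=
  ∀ σ τ : G, Γ (σ * τ) = Γ τ * Γ σ

/-- `Aut(G)`-equivariance of a map `Γ : G → Aut(G)`, where `Aut(G)` acts canonically on `G` and by
conjugation on itself. -/
def IsAutEquivariant {G : Type*} [Group G] (Γ : G → MulAut G) : Prop :=
  ∀ (φ : MulAut G) (σ : G), Γ (φ σ) = φ * Γ σ * φ⁻¹

namespace SplitMetacyclic

/-- The parameters allowed in the standard presentation of a finite non-abelian split metacyclic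
`p`-group with `p` an odd prime. -/
structure Params (p m n r : ℕ) : Prop where
  prime : p.Prime
  odd : Odd p
  two_le_m : 2 ≤ m
  one_le_n : 1 ≤ n
  one_le_r : 1 ≤ r
  r_le_n : r ≤ n
  r_lt_m : r ≤ m - 1

/-- The relators `X ^ p ^ m`, `Y ^ p ^ n` and `Y X Y⁻¹ = X ^ (1 + p ^ (m - r))` in the free group
on `X` (generator `0`) and `Y` (generator `1`). -/
def relators (p m n r : ℕ) : Set (FreeGroup (Fin 2)) :=
  {FreeGroup.of 0 ^ p ^ m, FreeGroup.of 1 ^ p ^ n,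
    FreeGroup.of 1 * FreeGroup.of 0 * (FreeGroup.of 1)⁻¹ *
      (FreeGroup.of 0 ^ (1 + p ^ (m - r)))⁻¹}

end SplitMetacyclic

/-- The group `⟨x, y : x ^ p ^ m = 1, y ^ p ^ n = 1, y x y⁻¹ = x ^ (1 + p ^ (m - r))⟩`. -/
abbrev SplitMetacyclic (p m n r : ℕ) : Type :=
  PresentedGroup (SplitMetacyclic.relators p m n r)

namespace SplitMetacyclic

/-- The generator `x`. -/
def x (p m n r : ℕ) : SplitMetacyclic p m n r := PresentedGroup.of 0

/-- The generator `y`. -/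
def y (p m n r : ℕ) : SplitMetacyclic p m n r := PresentedGroup.of 1

section Helpers

theorem dvd_geom (p : ℕ) (l : ℕ) (z : ℤ) (hz : (p : ℤ) ∣ z - 1) :
    ((p ^ l : ℕ) : ℤ) ∣ ∑ t ∈ Finset.range (p ^ l), z ^ t := by
  induction l with
  | zero => simp
  | succ l ih =>
    have key : ∑ t ∈ Finset.range (p ^ (l + 1)), z ^ t
        = (∑ t ∈ Finset.range (p ^ l), z ^ t) *
          ∑ s ∈ Finset.range p, (z ^ p ^ l) ^ s := by
      have h2 : ∀ N : ℕ, ∑ t ∈ Finset.range (p ^ l * N), z ^ t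
        = (∑ t ∈ Finset.range (p ^ l), z ^ t) * ∑ s ∈ Finset.range N, (z ^ p ^ l) ^ s := by
        intro N
        induction N with
        | zero => simp
        | succ N ihN =>
          rw [Nat.mul_succ, Finset.sum_range_add, ihN, Finset.sum_range_succ, mul_add]
          congr 1
          rw [Finset.sum_mul]
          refine Finset.sum_congr rfl fun t _ => ?_
          rw [pow_add, pow_mul]; ring
      rw [pow_succ]; exact h2 p
    have h1 : (p : ℤ) ∣ ∑ s ∈ Finset.range p, (z ^ p ^ l) ^ s := by
      have hz' : z ≡ 1 [ZMOD p] := (Int.modEq_iff_dvd.2 hz).symm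
      have : ∑ s ∈ Finset.range p, (z ^ p ^ l) ^ s ≡ ∑ s ∈ Finset.range p, 1 [ZMOD p] := by
        refine Int.ModEq.sum fun s _ => ?_
        simpa using (hz'.pow (p ^ l)).pow s
      refine (Int.modEq_zero_iff_dvd).1 (this.trans ?_)
      simp
    rw [key, pow_succ, Nat.cast_mul]
    exact mul_dvd_mul ih h1

variable {H : Type*} [Group H] {a b : H} {c : ℕ}

theorem pow_mul_zpow (hab : b * a * b⁻¹ = a ^ c) (j : ℕ) (i : ℤ) :
    b ^ j * a ^ i = a ^ ((c : ℤ) ^ j * i) * b ^ j := by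
  induction j generalizing i with
  | zero => simp
  | succ j ih =>
    have h1 : b * a ^ i = a ^ ((c : ℤ) * i) * b := by
      have : (b * a * b⁻¹) ^ i = a ^ ((c : ℤ) * i) := by
        rw [hab, zpow_mul, zpow_natCast]
      rw [conj_zpow] at this
      rw [← this]; group
    rw [pow_succ, mul_assoc, h1, ← mul_assoc, ih, mul_assoc, pow_succ, mul_assoc]

theorem zpow_mul_pow_pow (hab : b * a * b⁻¹ = a ^ c) (k : ℤ) (j l : ℕ) :
    (a ^ k * b ^ j) ^ l
      = a ^ (k * ∑ t ∈ Finset.range l, ((c : ℤ) ^ j) ^ t) * b ^ (j * l) := by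
  induction l with
  | zero => simp
  | succ l ih =>
    rw [pow_succ', ih, mul_assoc, ← mul_assoc (b ^ j), pow_mul_zpow hab, ← mul_assoc,
      ← mul_assoc, ← zpow_add, mul_assoc, ← pow_add, geom_sum_succ]
    congr 2 <;> ring

theorem zpow_eq_one_of_dvd {N : ℕ} (ha : a ^ N = 1) {i : ℤ} (hi : (N : ℤ) ∣ i) : a ^ i = 1 := by
  obtain ⟨q, rfl⟩ := hi
  rw [zpow_mul, zpow_natCast, ha, one_zpow]

theorem zpow_eq_of_dvd {N : ℕ} (ha : a ^ N = 1) {i j : ℤ} (hi : (N : ℤ) ∣ i - j) :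
    a ^ i = a ^ j := by
  have := zpow_eq_one_of_dvd ha hi
  rwa [zpow_sub, mul_inv_eq_one] at this

end Helpers

variable {p m n r : ℕ}

theorem x_pow : x p m n r ^ p ^ m = 1 := by
  have := PresentedGroup.one_of_mem (rels := relators p m n r)
    (x := FreeGroup.of 0 ^ p ^ m) (by simp [relators])
  rwa [map_pow] at this

theorem y_pow : y p m n r ^ p ^ n = 1 := by
  have := PresentedGroup.one_of_mem (rels := relators p m n r)
    (x := FreeGroup.of 1 ^ p ^ n) (by simp [relators])
  rwa [map_pow] at this

theorem y_conj_x :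
    y p m n r * x p m n r * (y p m n r)⁻¹ = x p m n r ^ (1 + p ^ (m - r)) := by
  have := PresentedGroup.one_of_mem (rels := relators p m n r)
    (x := FreeGroup.of 1 * FreeGroup.of 0 * (FreeGroup.of 1)⁻¹ *
      (FreeGroup.of 0 ^ (1 + p ^ (m - r)))⁻¹) (by simp [relators])
  rw [map_mul, map_mul, map_mul, map_inv, map_inv, map_pow, mul_inv_eq_one] at this
  exact this

theorem Params.dvd_c_sub_one (h : Params p m n r) (j : ℕ) :
    (p : ℤ) ∣ (((1 + p ^ (m - r) : ℕ) : ℤ)) ^ j - 1 := by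
  have h1 : (p : ℤ) ∣ ((1 + p ^ (m - r) : ℕ) : ℤ) - 1 := by
    have : m - r ≠ 0 := by have := h.r_lt_m; have := h.two_le_m; omega
    push_cast
    simpa using dvd_pow_self (p : ℤ) this
  have h2 := sub_dvd_pow_sub_pow (((1 + p ^ (m - r) : ℕ) : ℤ)) 1 j
  rw [one_pow] at h2
  exact h1.trans h2

theorem Params.dvd_c_pow_sub (h : Params p m n r) (j : ℕ) (hj : ((p ^ r : ℕ) : ℤ) ∣ (j : ℤ) - 1) :
    ((p ^ m : ℕ) : ℤ) ∣ (((1 + p ^ (m - r) : ℕ) : ℤ)) ^ j - ((1 + p ^ (m - r) : ℕ) : ℤ) := by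
  set c : ℤ := ((1 + p ^ (m - r) : ℕ) : ℤ) with hc
  have h0 : ((p ^ m : ℕ) : ℤ) ∣ c ^ p ^ r - 1 := by
    have h1 := geom_sum_mul c (p ^ r)
    rw [← h1]
    have h2 := dvd_geom p r c (by have := h.dvd_c_sub_one 1; rwa [pow_one] at this)
    have h3 : ((p ^ (m - r) : ℕ) : ℤ) ∣ c - 1 := by rw [hc]; push_cast; simp
    have h4 : ((p ^ m : ℕ) : ℤ) = ((p ^ r : ℕ) : ℤ) * ((p ^ (m - r) : ℕ) : ℤ) := by
      rw [← Nat.cast_mul, ← pow_add]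
      congr 2
      have := h.r_lt_m; omega
    rw [h4]; exact mul_dvd_mul h2 h3
  have hp : 2 ≤ p ^ r := by
    have := h.prime.two_le
    calc 2 ≤ p := this
      _ ≤ p ^ r := Nat.le_self_pow (by have := h.one_le_r; omega) p
  have hj1 : 1 ≤ j := by
    rcases Nat.eq_zero_or_pos j with rfl | hj'
    · exfalso
      have h5 : ((p ^ r : ℕ) : ℤ) ∣ 1 := by simpa using hj
      have := Int.le_of_dvd one_pos h5
      omega
    · exact hj'
  obtain ⟨i, rfl⟩ : ∃ i, j = i + 1 := ⟨j - 1, by omega⟩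
  have hi : p ^ r ∣ i := by
    have : ((p ^ r : ℕ) : ℤ) ∣ (i : ℤ) := by simpa using hj
    exact_mod_cast this
  obtain ⟨q, rfl⟩ := hi
  have h6 := sub_dvd_pow_sub_pow (c ^ p ^ r) 1 q
  rw [one_pow, ← pow_mul] at h6
  have h7 : c ^ (p ^ r * q + 1) - c = (c ^ (p ^ r * q) - 1) * c := by ring
  rw [h7]
  exact (h0.trans h6).mul_right c

/-- The endomorphism `x ↦ x ^ i`, `y ↦ x ^ k * y ^ j`. -/
def endo (h : Params p m n r) (i k : ℤ) (j : ℕ)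
    (hk : ((p ^ m : ℕ) : ℤ) ∣ k * ((p ^ n : ℕ) : ℤ)) (hj : ((p ^ r : ℕ) : ℤ) ∣ (j : ℤ) - 1) :
    SplitMetacyclic p m n r →* SplitMetacyclic p m n r :=
  PresentedGroup.toGroup (f := ![x p m n r ^ i, x p m n r ^ k * y p m n r ^ j]) (by
    intro w hw
    rcases hw with rfl | rfl | rfl
    · simp only [map_pow, FreeGroup.lift_apply_of, Matrix.cons_val_zero]
      rw [← zpow_natCast, zpow_comm, zpow_natCast, x_pow, one_zpow]
    · simp only [map_pow, FreeGroup.lift_apply_of, Matrix.cons_val_one, Matrix.cons_val_fin_one]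
      rw [zpow_mul_pow_pow y_conj_x, mul_comm j, pow_mul, y_pow, one_pow, mul_one]
      exact zpow_eq_one_of_dvd x_pow
        (hk.trans (mul_dvd_mul_left k (dvd_geom p n _ (h.dvd_c_sub_one j))))
    · simp only [map_mul, map_inv, map_pow, FreeGroup.lift_apply_of, Matrix.cons_val_zero,
        Matrix.cons_val_one, Matrix.cons_val_fin_one]
      rw [mul_inv_eq_one, mul_assoc (x p m n r ^ k), pow_mul_zpow y_conj_x]
      have h1 : x p m n r ^ (((1 + p ^ (m - r) : ℕ) : ℤ) ^ j * i)
          = (x p m n r ^ i) ^ (1 + p ^ (m - r)) := by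
        rw [← zpow_natCast, ← zpow_mul]
        refine zpow_eq_of_dvd x_pow ?_
        have := (h.dvd_c_pow_sub j hj).mul_right i
        rwa [sub_mul, mul_comm _ i, mul_comm _ i, mul_comm i] at this
      rw [h1, mul_inv_rev, ← zpow_natCast (x p m n r ^ i), ← zpow_mul]
      group)

section Endo

variable (h : Params p m n r) (i k : ℤ) (j : ℕ)
  (hk : ((p ^ m : ℕ) : ℤ) ∣ k * ((p ^ n : ℕ) : ℤ)) (hj : ((p ^ r : ℕ) : ℤ) ∣ (j : ℤ) - 1)

theorem endo_x : endo h i k j hk hj (x p m n r) = x p m n r ^ i :=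
  PresentedGroup.toGroup.of _

theorem endo_y : endo h i k j hk hj (y p m n r) = x p m n r ^ k * y p m n r ^ j :=
  PresentedGroup.toGroup.of _

end Endo

theorem hom_ext {K : Type*} [Group K] {f g : SplitMetacyclic p m n r →* K}
    (hx : f (x p m n r) = g (x p m n r)) (hy : f (y p m n r) = g (y p m n r)) : f = g := by
  refine PresentedGroup.ext fun t => ?_
  fin_cases t
  · exact hx
  · exact hy

/-- The automorphism `α` with `α x = x ^ u` and `α y = y`, for a unit `u` modulo `p ^ m`. -/
def alpha (h : Params p m n r) (u : (ZMod (p ^ m))ˣ) : MulAut (SplitMetacyclic p m n r) :=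
  have hu : ∀ v : (ZMod (p ^ m))ˣ, ((p ^ m : ℕ) : ℤ) ∣
      (((v : ZMod (p ^ m)).val : ℤ) * ((v⁻¹ : (ZMod (p ^ m))ˣ) : ZMod (p ^ m)).val) - 1 := by
    intro v
    have : NeZero (p ^ m) := ⟨pow_ne_zero _ h.prime.ne_zero⟩
    rw [← ZMod.intCast_zmod_eq_zero_iff_dvd]
    simp
  MonoidHom.toMulEquiv
    (endo h ((u : ZMod (p ^ m)).val : ℤ) 0 1 (by simp) (by simp))
    (endo h (((u⁻¹ : (ZMod (p ^ m))ˣ) : ZMod (p ^ m)).val : ℤ) 0 1 (by simp) (by simp))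
    (hom_ext
      (by
        simp only [MonoidHom.comp_apply, MonoidHom.id_apply, endo_x, map_zpow, ← zpow_mul]
        rw [zpow_eq_of_dvd (j := 1) x_pow (by rw [mul_comm]; exact hu u), zpow_one])
      (by simp [endo_y]))
    (hom_ext
      (by
        simp only [MonoidHom.comp_apply, MonoidHom.id_apply, endo_x, map_zpow, ← zpow_mul]
        rw [zpow_eq_of_dvd (j := 1) x_pow (hu u), zpow_one])
      (by simp [endo_y]))

theorem alpha_x (h : Params p m n r) (u : (ZMod (p ^ m))ˣ) :
    alpha h u (x p m n r) = x p m n r ^ (u : ZMod (p ^ m)).val := by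
  simp only [alpha]
  rw [MonoidHom.toMulEquiv_apply, endo_x]
  rw [zpow_natCast]

theorem alpha_y (h : Params p m n r) (u : (ZMod (p ^ m))ˣ) :
    alpha h u (y p m n r) = y p m n r := by
  simp only [alpha]
  rw [MonoidHom.toMulEquiv_apply, endo_y]
  simp

/-- The automorphism `β` with `β x = x` and `β y = x ^ p ^ max (m - n) 0 * y`
(the truncated difference `m - n` of natural numbers is this maximum). -/
def beta (h : Params p m n r) : MulAut (SplitMetacyclic p m n r) :=
  have hk : ((p ^ m : ℕ) : ℤ) ∣ ((p ^ (m - n) : ℕ) : ℤ) * ((p ^ n : ℕ) : ℤ) := by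
    rw [← Nat.cast_mul, ← pow_add, Int.natCast_dvd_natCast]
    exact pow_dvd_pow p (by omega)
  MonoidHom.toMulEquiv
    (endo h 1 ((p ^ (m - n) : ℕ) : ℤ) 1 hk (by simp))
    (endo h 1 (-((p ^ (m - n) : ℕ) : ℤ)) 1 (by rw [neg_mul]; exact (dvd_neg).2 hk) (by simp))
    (hom_ext (by simp [endo_x]) (by
      simp only [MonoidHom.comp_apply, MonoidHom.id_apply, endo_y, endo_x, map_mul, map_zpow,
        pow_one, zpow_one]
      rw [← mul_assoc, ← zpow_add, add_neg_cancel, zpow_zero, one_mul]))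
    (hom_ext (by simp [endo_x]) (by
      simp only [MonoidHom.comp_apply, MonoidHom.id_apply, endo_y, endo_x, map_mul, map_zpow,
        pow_one, zpow_one]
      rw [← mul_assoc, ← zpow_add, neg_add_cancel, zpow_zero, one_mul]))

theorem beta_x (h : Params p m n r) : beta h (x p m n r) = x p m n r := by
  simp only [beta]
  rw [MonoidHom.toMulEquiv_apply, endo_x]
  simp

theorem beta_y (h : Params p m n r) :
    beta h (y p m n r) = x p m n r ^ p ^ (m - n) * y p m n r := by
  simp only [beta]
  rw [MonoidHom.toMulEquiv_apply, endo_y]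
  rw [zpow_natCast, pow_one]

/-- The automorphism `δ` with `δ x = x` and `δ y = y ^ (1 + p ^ r)`. -/
def delta (h : Params p m n r) : MulAut (SplitMetacyclic p m n r) :=
  have hj : ((p ^ r : ℕ) : ℤ) ∣ ((1 + p ^ r : ℕ) : ℤ) - 1 := by push_cast; simp
  have hj' : ((p ^ r : ℕ) : ℤ) ∣ (((1 + p ^ r) ^ (p ^ n - 1) : ℕ) : ℤ) - 1 := by
    have h2 := sub_dvd_pow_sub_pow ((1 + p ^ r : ℕ) : ℤ) 1 (p ^ n - 1)
    rw [one_pow] at h2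
    rw [Nat.cast_pow (1 + p ^ r)]
    exact hj.trans h2
  have key : y p m n r ^ ((1 + p ^ r) ^ (p ^ n - 1) * (1 + p ^ r)) = y p m n r := by
    have hp : p ^ n ≠ 0 := pow_ne_zero _ h.prime.ne_zero
    rw [← pow_succ, Nat.sub_add_cancel (Nat.one_le_iff_ne_zero.2 hp), ← zpow_natCast]
    conv_rhs => rw [← zpow_one (y p m n r)]
    refine zpow_eq_of_dvd y_pow ?_
    rw [Nat.cast_pow (1 + p ^ r), ← geom_sum_mul]
    refine Dvd.dvd.mul_right (dvd_geom p n _ (dvd_trans ?_ hj)) _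
    exact_mod_cast dvd_pow_self p (by have := h.one_le_r; omega)
  MonoidHom.toMulEquiv
    (endo h 1 0 (1 + p ^ r) (by simp) hj)
    (endo h 1 0 ((1 + p ^ r) ^ (p ^ n - 1)) (by simp) hj')
    (hom_ext (by simp [endo_x]) (by
      simp only [MonoidHom.comp_apply, MonoidHom.id_apply, endo_y, map_pow, zpow_zero,
        one_mul]
      rw [← pow_mul, key]))
    (hom_ext (by simp [endo_x]) (by
      simp only [MonoidHom.comp_apply, MonoidHom.id_apply, endo_y, map_pow, zpow_zero,
        one_mul]
      rw [← pow_mul, mul_comm, key]))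

theorem delta_x (h : Params p m n r) : delta h (x p m n r) = x p m n r := by
  simp only [delta]
  rw [MonoidHom.toMulEquiv_apply, endo_x]
  simp

theorem delta_y (h : Params p m n r) :
    delta h (y p m n r) = y p m n r ^ (1 + p ^ r) := by
  simp only [delta]
  rw [MonoidHom.toMulEquiv_apply, endo_y]
  simp

/-- `α̃ = α ^ ((p - 1) * p ^ (m - r - 1))`. -/
def alphaTilde (h : Params p m n r) (u : (ZMod (p ^ m))ˣ) : MulAut (SplitMetacyclic p m n r) :=
  alpha h u ^ ((p - 1) * p ^ (m - r - 1))

/-- `β̃ = β ^ p ^ (min m n - r)`. -/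
def betaTilde (h : Params p m n r) : MulAut (SplitMetacyclic p m n r) :=
  beta h ^ p ^ (min m n - r)

/-- `δ̃ = δ ^ p ^ max (n - 2 r) 0` (the truncated difference `n - 2 * r` is this maximum). -/
def deltaTilde (h : Params p m n r) : MulAut (SplitMetacyclic p m n r) :=
  delta h ^ p ^ (n - 2 * r)

/-- `Γ` extends the assignment `x ↦ β̃ ^ b`, `y ↦ α̃ ^ a * δ̃ ^ d` to an antihomomorphism,
that is, `Γ` is the antihomomorphism `Γ_{a,b,d}`. -/
structure IsGammaABD (h : Params p m n r) (u : (ZMod (p ^ m))ˣ) (a b d : ℤ)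
    (Γ : SplitMetacyclic p m n r → MulAut (SplitMetacyclic p m n r)) : Prop where
  antihom : IsAntihom Γ
  map_x : Γ (x p m n r) = betaTilde h ^ b
  map_y : Γ (y p m n r) = alphaTilde h u ^ a * deltaTilde h ^ d

end SplitMetacyclic

/-! Equivariance turns every automorphism fixing `σ` into one commuting with `Γ σ`, and every
automorphism raising `σ` to a power into a power relation for `Γ σ`. Together with the unique normal
form `x ^ k * y ^ j` (`k` mod `p ^ m`, `j` mod `p ^ n`), this pins down `Γ` on the generators. Put
`c = 1 + p ^ (m - r)`.

Since `α` fixes `y`, `Γ y` commutes with `α`; as `u - 1` is prime to `p`, `Γ y` preserves `⟨x⟩` and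
`⟨y⟩`, say `x ↦ x ^ i`, `y ↦ y ^ j`. So it commutes with `δ` too, and equivariance under `δ` gives
`Γ y ^ (1 + p ^ r) = Γ y`. Now `i` and `j` are killed by `p ^ r`, and `j ≡ 1` mod `p ^ r`; in the
cyclic unit groups this places them in the subgroups that define `α̃` and `δ̃`.

Since `β` fixes `x`, `Γ x` commutes with `β`, hence preserves `⟨x⟩`. Equivariance under `α`
conjugates `Γ x` to its `u`-th power, and `Γ x ^ p ^ m = 1`; these force `x ↦ x`, `y ↦ x ^ k * y`.
Commutation with `δ` gives `p ^ (m - r) ∣ k`, which describes the powers of `β̃`. -/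

/-! ### Cyclic groups and orders modulo prime powers. -/

/-- In a finite cyclic group `a ^ N = 1` has at most `N` solutions; for `N = orderOf k`, `⟨k⟩`
already supplies them all. -/
theorem IsCyclic.mem_zpowers_of_orderOf_dvd {C : Type*} [Group C] [Finite C] [IsCyclic C]
    {g k : C} (hgk : orderOf g ∣ orderOf k) : g ∈ Subgroup.zpowers k := by
  classical
  have := Fintype.ofFinite C
  have hk : 0 < orderOf k := orderOf_pos k
  have hle := IsCyclic.card_pow_eq_one_le (α := C) hk
  have hsub : (Finset.univ.filter fun a : C => a ∈ Subgroup.zpowers k) ⊆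
      Finset.univ.filter fun a : C => a ^ orderOf k = 1 := by
    intro a ha
    simp only [Finset.mem_filter, Finset.mem_univ, true_and] at ha ⊢
    obtain ⟨s, rfl⟩ := ha
    simp only
    rw [← zpow_natCast, zpow_comm, zpow_natCast, pow_orderOf_eq_one, one_zpow]
  have hcard : (Finset.univ.filter fun a : C => a ∈ Subgroup.zpowers k).card = orderOf k := by
    rw [← Nat.card_zpowers, Nat.card_eq_fintype_card, Fintype.card_subtype]
  have heq := Finset.eq_of_subset_of_card_le hsub (by rw [hcard]; exact hle)
  have : g ∈ Finset.univ.filter fun a : C => a ^ orderOf k = 1 := by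
    simpa using orderOf_dvd_iff_pow_eq_one.1 hgk
  rw [← heq] at this
  simpa using this

theorem eq_one_of_pow_eq_self_of_pow_eq_one {M : Type*} [Monoid M] {a : M} {U N : ℕ}
    (hU : 1 ≤ U) (hUN : (U - 1).Coprime N) (hN : 0 < N) (haU : a ^ U = a) (haN : a ^ N = 1) :
    a = 1 := by
  have h1 : a ^ (U - 1) = 1 := by
    have h2 : IsUnit a := IsUnit.of_pow_eq_one haN hN.ne'
    rw [← h2.mul_left_inj, ← pow_succ, Nat.sub_add_cancel hU, haU, one_mul]
  rw [← orderOf_eq_one_iff, ← Nat.dvd_one, ← hUN]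
  exact Nat.dvd_gcd (orderOf_dvd_of_pow_eq_one h1) (orderOf_dvd_of_pow_eq_one haN)

theorem intCast_zmod_eq_iff_dvd_sub (N : ℕ) (a b : ℤ) :
    (a : ZMod N) = b ↔ (N : ℤ) ∣ a - b := by
  rw [← ZMod.intCast_zmod_eq_zero_iff_dvd, Int.cast_sub, sub_eq_zero]

/-- Oddness is essential: `1 + 2` has order 2, not 4, modulo 8. -/
theorem orderOf_one_add_prime_pow {p : ℕ} (hp : p.Prime) (hodd : Odd p) {s : ℕ} (hs : s ≠ 0)
    (t : ℕ) : orderOf (1 + (p : ZMod (p ^ (t + s))) ^ s) = p ^ t := by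
  have h3 : 3 ≤ p := by
    have := hp.two_le
    rcases hodd with ⟨q, rfl⟩
    omega
  have := ZMod.orderOf_one_add_mul_prime_pow hp s hs (by nlinarith [Nat.pos_of_ne_zero hs]) 1
    (fun H => hp.ne_one (by exact_mod_cast Int.eq_one_of_dvd_one (Int.natCast_nonneg p) H)) t
  simpa using this

theorem prime_pow_dvd_one_add_pow_sub_one {p : ℕ} (hp : p.Prime) (hodd : Odd p) {s : ℕ}
    (hs : s ≠ 0) (t l : ℕ) :
    ((p ^ (t + s) : ℕ) : ℤ) ∣ ((1 + p ^ s : ℕ) : ℤ) ^ l - 1 ↔ p ^ t ∣ l := by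
  rw [← orderOf_one_add_prime_pow hp hodd hs t, orderOf_dvd_iff_pow_eq_one,
    ← ZMod.intCast_zmod_eq_zero_iff_dvd]
  push_cast
  rw [sub_eq_zero]

namespace SplitMetacyclic

variable {p m n r : ℕ}

theorem Params.r_lt (h : Params p m n r) : r < m := by
  have := h.r_lt_m; have := h.two_le_m; omega

theorem Params.dvd_pow_sub_one (h : Params p m n r) (l : ℕ) :
    ((p ^ m : ℕ) : ℤ) ∣ ((1 + p ^ (m - r) : ℕ) : ℤ) ^ l - 1 ↔ p ^ r ∣ l := by
  have := h.r_lt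
  have h1 := prime_pow_dvd_one_add_pow_sub_one h.prime h.odd (s := m - r) (by omega) r l
  rwa [show r + (m - r) = m by omega] at h1

/-- Multiplying the sum by `c - 1 = p ^ (m - r)` gives `c ^ l - 1`, so the sum has the same `p`-adic
valuation as `l`. -/
theorem Params.dvd_sum (h : Params p m n r) (a l : ℕ) :
    ((p ^ a : ℕ) : ℤ) ∣ ∑ t ∈ Finset.range l, ((1 + p ^ (m - r) : ℕ) : ℤ) ^ t ↔ p ^ a ∣ l := by
  have := h.r_lt
  rw [← prime_pow_dvd_one_add_pow_sub_one h.prime h.odd (s := m - r) (by omega) a l,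
    ← geom_sum_mul, pow_add]
  have h2 : ((1 + p ^ (m - r) : ℕ) : ℤ) - 1 = ((p ^ (m - r) : ℕ) : ℤ) := by push_cast; ring
  rw [h2, Nat.cast_mul]
  refine (mul_dvd_mul_iff_right ?_).symm
  exact_mod_cast pow_ne_zero _ h.prime.ne_zero

/-! ### The unique normal form. -/

theorem exists_eq_zpow_mul_pow (h : Params p m n r) (g : SplitMetacyclic p m n r) :
    ∃ (k : ℤ) (j : ℕ), g = x p m n r ^ k * y p m n r ^ j := by
  have hg : g ∈ Subgroup.closure (Set.range PresentedGroup.of) := by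
    rw [PresentedGroup.closure_range_of]; trivial
  induction hg using Subgroup.closure_induction with
  | mem g hg =>
    obtain ⟨i, rfl⟩ := hg
    fin_cases i
    · exact ⟨1, 0, by simp [x]⟩
    · exact ⟨0, 1, by simp [y]⟩
  | one => exact ⟨0, 0, by simp⟩
  | mul a b _ _ ha hb =>
    obtain ⟨k, j, rfl⟩ := ha
    obtain ⟨k', j', rfl⟩ := hb
    refine ⟨k + ((1 + p ^ (m - r) : ℕ) : ℤ) ^ j * k', j + j', ?_⟩
    rw [zpow_add, pow_add, mul_assoc, ← mul_assoc (_ ^ j), pow_mul_zpow y_conj_x]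
    simp only [mul_assoc]
  | inv a _ ha =>
    obtain ⟨k, j, rfl⟩ := ha
    have hp : p ^ n - 1 + 1 = p ^ n := Nat.sub_add_cancel (Nat.pos_of_ne_zero
      (pow_ne_zero _ h.prime.ne_zero))
    refine ⟨((1 + p ^ (m - r) : ℕ) : ℤ) ^ ((p ^ n - 1) * j) * (-k), (p ^ n - 1) * j, ?_⟩
    rw [← pow_mul_zpow y_conj_x, mul_inv_rev, zpow_neg]
    congr 1
    rw [inv_eq_iff_mul_eq_one, ← pow_add, show j + (p ^ n - 1) * j = p ^ n * j by
      rw [← hp]; simp; ring, pow_mul, y_pow, one_pow]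

/-- The action of the group on `ZMod (p ^ m)` by affine maps. -/
def affineRep (h : Params p m n r) : SplitMetacyclic p m n r →* Equiv.Perm (ZMod (p ^ m)) :=
  have hc : (1 + (p : ZMod (p ^ m)) ^ (m - r)) ^ p ^ n = 1 := by
    have h1 := (h.dvd_pow_sub_one (p ^ n)).2 (pow_dvd_pow p h.r_le_n)
    rw [← ZMod.intCast_zmod_eq_zero_iff_dvd] at h1
    push_cast at h1
    exact sub_eq_zero.1 h1
  let c : (ZMod (p ^ m))ˣ := Units.ofPowEqOne _ _ hc (pow_ne_zero _ h.prime.ne_zero)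
  have ht : ∀ l : ℕ, (Equiv.addLeft (1 : ZMod (p ^ m))) ^ l = Equiv.addLeft (l : ZMod (p ^ m)) := by
    intro l
    induction l with
    | zero => ext; simp
    | succ l ih => ext z; rw [pow_succ, ih]; simp
  PresentedGroup.toGroup
    (f := ![Equiv.addLeft (1 : ZMod (p ^ m)), MulAction.toPermHom _ (ZMod (p ^ m)) c]) (by
    intro w hw
    rcases hw with rfl | rfl | rfl
    · simp only [map_pow, FreeGroup.lift_apply_of, Matrix.cons_val_zero]
      rw [ht, ZMod.natCast_self]
      ext; simp
    · simp only [map_pow, FreeGroup.lift_apply_of, Matrix.cons_val_one, Matrix.cons_val_fin_one]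
      rw [← map_pow, Units.pow_ofPowEqOne, map_one]
    · simp only [map_mul, map_inv, map_pow, FreeGroup.lift_apply_of, Matrix.cons_val_zero,
        Matrix.cons_val_one, Matrix.cons_val_fin_one]
      rw [mul_inv_eq_one, mul_inv_eq_iff_eq_mul, ht]
      ext z
      simp [c, Units.smul_def])

theorem affineRep_x_pow (h : Params p m n r) (l : ℕ) :
    affineRep h (x p m n r ^ l) 0 = (l : ZMod (p ^ m)) := by
  have h1 : affineRep h (x p m n r) = Equiv.addLeft 1 := by
    unfold affineRep
    exact PresentedGroup.toGroup.of _
  induction l with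
  | zero => simp
  | succ l ih => rw [pow_succ', map_mul, Equiv.Perm.mul_apply, ih, h1]; simp; ring

/-- The presentation does not collapse `⟨x⟩`: `x` acts on `ZMod (p ^ m)` as translation by 1. -/
theorem orderOf_x (h : Params p m n r) : orderOf (x p m n r) = p ^ m := by
  refine Nat.dvd_antisymm (orderOf_dvd_of_pow_eq_one x_pow) ?_
  rw [← ZMod.natCast_eq_zero_iff, ← affineRep_x_pow h, pow_orderOf_eq_one, map_one]
  rfl

/-- The quotient map of the group by `⟨x⟩`. -/
def yExponent (p m n r : ℕ) : SplitMetacyclic p m n r →* Multiplicative (ZMod (p ^ n)) :=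
  PresentedGroup.toGroup (f := ![1, Multiplicative.ofAdd 1]) (by
    intro w hw
    rcases hw with rfl | rfl | rfl
    · simp
    · simp [← ofAdd_nsmul]
    · simp)

theorem yExponent_x : yExponent p m n r (x p m n r) = 1 := PresentedGroup.toGroup.of _

theorem yExponent_y : yExponent p m n r (y p m n r) = Multiplicative.ofAdd 1 :=
  PresentedGroup.toGroup.of _

theorem yExponent_zpow_mul_pow (k : ℤ) (j : ℕ) :
    yExponent p m n r (x p m n r ^ k * y p m n r ^ j) = Multiplicative.ofAdd (j : ZMod (p ^ n)) := by
  rw [map_mul, map_zpow, map_pow, yExponent_x, yExponent_y, one_zpow, one_mul, ← ofAdd_nsmul,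
    nsmul_one]

theorem x_zpow_eq_iff (h : Params p m n r) (k k' : ℤ) :
    x p m n r ^ k = x p m n r ^ k' ↔ ((p ^ m : ℕ) : ℤ) ∣ k - k' := by
  rw [← orderOf_x h, orderOf_dvd_iff_zpow_eq_one, zpow_sub, mul_inv_eq_one]

theorem zpow_mul_pow_eq_iff (h : Params p m n r) (k k' : ℤ) (j j' : ℕ) :
    x p m n r ^ k * y p m n r ^ j = x p m n r ^ k' * y p m n r ^ j' ↔
      ((p ^ m : ℕ) : ℤ) ∣ k - k' ∧ (j : ZMod (p ^ n)) = j' := by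
  have hy : (j : ZMod (p ^ n)) = j' → y p m n r ^ j = y p m n r ^ j' := fun hj => by
    rw [← zpow_natCast, ← zpow_natCast _ j']
    refine zpow_eq_of_dvd y_pow ?_
    rw [← intCast_zmod_eq_iff_dvd_sub]
    simpa using hj
  constructor
  · intro he
    have hj := congrArg (fun g => Multiplicative.toAdd (yExponent p m n r g)) he
    simp only [yExponent_zpow_mul_pow, toAdd_ofAdd] at hj
    refine ⟨?_, hj⟩
    rw [hy hj] at he
    exact (x_zpow_eq_iff h k k').1 (mul_right_cancel he)
  · rintro ⟨hk, hj⟩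
    rw [hy hj, (x_zpow_eq_iff h k k').2 hk]

/-! ### The automorphisms `α`, `β`, `δ` in coordinates. -/

theorem aut_ext {φ ψ : MulAut (SplitMetacyclic p m n r)}
    (hx : φ (x p m n r) = ψ (x p m n r)) (hy : φ (y p m n r) = ψ (y p m n r)) : φ = ψ :=
  MulEquiv.toMonoidHom_injective (hom_ext hx hy)

theorem y_pow_eq_iff (h : Params p m n r) (j j' : ℕ) :
    y p m n r ^ j = y p m n r ^ j' ↔ (j : ZMod (p ^ n)) = j' := by
  simpa using zpow_mul_pow_eq_iff h 0 0 j j'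

theorem one_le_val (h : Params p m n r) (u : (ZMod (p ^ m))ˣ) : 1 ≤ (u : ZMod (p ^ m)).val := by
  have : Fact (1 < p ^ m) := ⟨Nat.one_lt_pow (by have := h.two_le_m; omega) h.prime.one_lt⟩
  rw [Nat.one_le_iff_ne_zero, Ne, ZMod.val_eq_zero]
  exact u.ne_zero

/-- If `u ≡ 1` mod `p`, all powers of `u`, among them `-1`, reduce to 1 mod `p`, forcing `p = 2`. -/
theorem coprime_val_sub_one (h : Params p m n r) {u : (ZMod (p ^ m))ˣ}
    (hu : Subgroup.zpowers u = ⊤) : ((u : ZMod (p ^ m)).val - 1).Coprime p := by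
  have hpm : p ∣ p ^ m := dvd_pow_self p (by have := h.two_le_m; omega)
  have hp0 : NeZero (p ^ m) := ⟨pow_ne_zero _ h.prime.ne_zero⟩
  rw [Nat.coprime_comm, h.prime.coprime_iff_not_dvd]
  intro hd
  have h1 : ZMod.unitsMap hpm u = 1 := by
    ext
    rw [ZMod.unitsMap_val, Units.val_one, ZMod.cast_eq_val]
    have h2 : (u : ZMod (p ^ m)).val ≡ 1 [MOD p] :=
      ((Nat.modEq_iff_dvd' (one_le_val h u)).2 hd).symm
    simpa using (ZMod.natCast_eq_natCast_iff _ _ _).2 h2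
  obtain ⟨s, hs⟩ := Subgroup.mem_zpowers_iff.1 (hu ▸ Subgroup.mem_top (-1 : (ZMod (p ^ m))ˣ))
  have h2 : ZMod.unitsMap hpm (-1) = 1 := by rw [← hs, map_zpow, h1, one_zpow]
  have h3 : (-1 : ZMod p) = 1 := by
    have := congrArg Units.val h2
    rw [ZMod.unitsMap_val] at this
    simpa [ZMod.cast_neg hpm, ZMod.cast_one hpm] using this
  have h4 : ((2 : ℕ) : ZMod p) = 0 := by
    have : (1 : ZMod p) + 1 = 0 := by nth_rewrite 1 [← h3]; simp
    push_cast
    rw [← one_add_one_eq_two, this]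
  rw [ZMod.natCast_eq_zero_iff, Nat.prime_dvd_prime_iff_eq h.prime Nat.prime_two] at h4
  have := h.odd
  rw [h4] at this
  exact absurd this (by decide)

theorem alpha_zpow_mul_pow (h : Params p m n r) (u : (ZMod (p ^ m))ˣ) (k : ℤ) (j : ℕ) :
    alpha h u (x p m n r ^ k * y p m n r ^ j) =
      x p m n r ^ ((u : ZMod (p ^ m)).val * k) * y p m n r ^ j := by
  rw [map_mul, map_zpow, map_pow, alpha_x, alpha_y, zpow_mul, zpow_natCast]

theorem delta_zpow_mul_pow (h : Params p m n r) (k : ℤ) (j : ℕ) :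
    delta h (x p m n r ^ k * y p m n r ^ j) =
      x p m n r ^ k * y p m n r ^ ((1 + p ^ r) * j) := by
  rw [map_mul, map_zpow, map_pow, delta_x, delta_y, pow_mul]

theorem beta_zpow_mul_pow (h : Params p m n r) (k : ℤ) (j : ℕ) :
    beta h (x p m n r ^ k * y p m n r ^ j) =
      x p m n r ^ (k + ((p ^ (m - n) : ℕ) : ℤ) *
        ∑ t ∈ Finset.range j, ((1 + p ^ (m - r) : ℕ) : ℤ) ^ t) * y p m n r ^ j := by
  have h1 := zpow_mul_pow_pow (y_conj_x (p := p) (m := m) (n := n) (r := r))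
    ((p ^ (m - n) : ℕ) : ℤ) 1 j
  rw [pow_one, pow_one, one_mul, zpow_natCast] at h1
  rw [map_mul, map_zpow, map_pow, beta_x, beta_y, h1, zpow_add, mul_assoc]

theorem alpha_pow_x (h : Params p m n r) (u : (ZMod (p ^ m))ˣ) (k : ℕ) :
    (alpha h u ^ k) (x p m n r) = x p m n r ^ (((u : ZMod (p ^ m)).val : ℤ) ^ k) := by
  induction k with
  | zero => simp
  | succ k ih =>
    rw [pow_succ', MulAut.mul_apply, ih, map_zpow, alpha_x, ← zpow_natCast, ← zpow_mul, pow_succ']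

theorem alpha_pow_y (h : Params p m n r) (u : (ZMod (p ^ m))ˣ) (k : ℕ) :
    (alpha h u ^ k) (y p m n r) = y p m n r := by
  induction k with
  | zero => simp
  | succ k ih => rw [pow_succ', MulAut.mul_apply, ih, alpha_y]

theorem delta_pow_y (h : Params p m n r) (k : ℕ) :
    (delta h ^ k) (y p m n r) = y p m n r ^ ((1 + p ^ r) ^ k) := by
  induction k with
  | zero => simp
  | succ k ih => rw [pow_succ', MulAut.mul_apply, ih, map_pow, delta_y, ← pow_mul, pow_succ']

theorem delta_pow_x (h : Params p m n r) (k : ℕ) :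
    (delta h ^ k) (x p m n r) = x p m n r := by
  induction k with
  | zero => simp
  | succ k ih => rw [pow_succ', MulAut.mul_apply, ih, delta_x]

theorem beta_pow_x (h : Params p m n r) (k : ℕ) :
    (beta h ^ k) (x p m n r) = x p m n r := by
  induction k with
  | zero => simp
  | succ k ih => rw [pow_succ', MulAut.mul_apply, ih, beta_x]

theorem beta_pow_y (h : Params p m n r) (k : ℕ) :
    (beta h ^ k) (y p m n r) = x p m n r ^ (p ^ (m - n) * k) * y p m n r := by
  induction k with
  | zero => simp
  | succ k ih =>
    rw [pow_succ', MulAut.mul_apply, ih, map_mul, map_pow, beta_x, beta_y, ← mul_assoc, ← pow_add,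
      Nat.mul_succ]

theorem commute_alpha_delta (h : Params p m n r) (u : (ZMod (p ^ m))ˣ) :
    Commute (alpha h u) (delta h) := by
  refine aut_ext ?_ ?_ <;>
    simp [MulAut.mul_apply, alpha_x, alpha_y, delta_x, delta_y]

theorem disjoint_zpowers_alpha_delta (h : Params p m n r) (u : (ZMod (p ^ m))ˣ) :
    Disjoint (Subgroup.zpowers (alpha h u)) (Subgroup.zpowers (delta h)) := by
  rw [Subgroup.disjoint_def]
  intro φ hα hδ
  have hy : Subgroup.zpowers (alpha h u) ≤ MulAction.stabilizer _ (y p m n r) := by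
    rw [Subgroup.zpowers_le]; exact alpha_y h u
  have hx : Subgroup.zpowers (delta h) ≤ MulAction.stabilizer _ (x p m n r) := by
    rw [Subgroup.zpowers_le]; exact delta_x h
  exact aut_ext (hx hδ) (hy hα)

/-! ### Automorphisms preserving `⟨x⟩`. -/

theorem pow_apply_x {φ : MulAut (SplitMetacyclic p m n r)} {i : ℤ}
    (hx : φ (x p m n r) = x p m n r ^ i) (N : ℕ) :
    (φ ^ N) (x p m n r) = x p m n r ^ (i ^ N) := by
  induction N with
  | zero => simp
  | succ N ih => rw [pow_succ', MulAut.mul_apply, ih, map_zpow, hx, ← zpow_mul, pow_succ']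

theorem exists_pow_apply_y {φ : MulAut (SplitMetacyclic p m n r)} {i k : ℤ}
    {j : ℕ} (hx : φ (x p m n r) = x p m n r ^ i)
    (hy : φ (y p m n r) = x p m n r ^ k * y p m n r ^ j) (N : ℕ) :
    ∃ k' : ℤ, (φ ^ N) (y p m n r) = x p m n r ^ k' * y p m n r ^ (j ^ N) := by
  induction N with
  | zero => exact ⟨0, by simp⟩
  | succ N ih =>
    obtain ⟨k', hk'⟩ := ih
    rw [pow_succ', MulAut.mul_apply, hk', map_mul, map_zpow, map_pow, hx, hy,
      zpow_mul_pow_pow y_conj_x, ← zpow_mul, ← mul_assoc, ← zpow_add, pow_succ' j]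
    exact ⟨_, rfl⟩

/-- Otherwise `φ` would kill `x ^ p ^ (m - 1)`, which is nontrivial. -/
theorem not_dvd_of_apply_x (h : Params p m n r) {φ : MulAut (SplitMetacyclic p m n r)} {i : ℤ}
    (hx : φ (x p m n r) = x p m n r ^ i) : ¬ (p : ℤ) ∣ i := by
  rintro ⟨q, rfl⟩
  have hm : m - 1 + 1 = m := by have := h.two_le_m; omega
  have h1 : φ (x p m n r ^ p ^ (m - 1)) = 1 := by
    rw [map_pow, hx, ← zpow_natCast, ← zpow_mul]
    refine zpow_eq_one_of_dvd x_pow ⟨q, ?_⟩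
    nth_rewrite 2 [← hm]
    push_cast [pow_succ]
    ring
  rw [map_eq_one_iff _ φ.injective] at h1
  have h2 := orderOf_dvd_of_pow_eq_one h1
  rw [orderOf_x h, Nat.pow_dvd_pow_iff_le_right h.prime.one_lt] at h2
  omega

/-- Applying `φ` to `y * x * y⁻¹ = x ^ c` yields `c ^ j * i ≡ c * i` mod `p ^ m`; here `i` is
invertible and `c` has order `p ^ r`. -/
theorem dvd_sub_one_of_apply (h : Params p m n r) {φ : MulAut (SplitMetacyclic p m n r)}
    {i k : ℤ} {j : ℕ} (hx : φ (x p m n r) = x p m n r ^ i)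
    (hy : φ (y p m n r) = x p m n r ^ k * y p m n r ^ j) : ((p ^ r : ℕ) : ℤ) ∣ (j : ℤ) - 1 := by
  have h1 := congrArg φ (y_conj_x (p := p) (m := m) (n := n) (r := r))
  rw [map_mul, map_mul, map_inv, map_pow, mul_inv_eq_iff_eq_mul, hx, hy, mul_assoc,
    pow_mul_zpow y_conj_x, ← mul_assoc, ← mul_assoc, ← zpow_add, ← zpow_natCast (x p m n r ^ i),
    ← zpow_mul, ← zpow_add, zpow_mul_pow_eq_iff h] at h1
  set c : ℤ := ((1 + p ^ (m - r) : ℕ) : ℤ)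
  have h2 := h1.1
  rw [show k + c ^ j * i - (i * c + k) = (c ^ j - c) * i by ring] at h2
  have h3 : IsCoprime ((p ^ m : ℕ) : ℤ) i := by
    push_cast
    exact ((Nat.prime_iff_prime_int.1 h.prime).coprime_iff_not_dvd.2
      (not_dvd_of_apply_x h hx)).pow_left
  have h4 := h3.dvd_of_dvd_mul_right h2
  have hp : 1 ≤ p ^ r := Nat.pos_of_ne_zero (pow_ne_zero _ h.prime.ne_zero)
  -- Multiplying by `c ^ (p ^ r - 1)` stands in for dividing by `c`, so exponents stay natural even
  -- when `j = 0`.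
  have h5 : ((p ^ m : ℕ) : ℤ) ∣ c ^ (j + (p ^ r - 1)) - 1 := by
    have h6 := dvd_add (h4.mul_right (c ^ (p ^ r - 1))) ((h.dvd_pow_sub_one (p ^ r)).2 dvd_rfl)
    have h7 : (c ^ j - c) * c ^ (p ^ r - 1) + (c ^ (p ^ r - 1 + 1) - 1) =
        c ^ (j + (p ^ r - 1)) - 1 := by ring
    rwa [← h7, Nat.sub_add_cancel hp]
  rw [h.dvd_pow_sub_one, ← Int.natCast_dvd_natCast] at h5
  have h6 := dvd_sub h5 (dvd_refl ((p ^ r : ℕ) : ℤ))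
  have h7 : ((j + (p ^ r - 1) : ℕ) : ℤ) - ((p ^ r : ℕ) : ℤ) = (j : ℤ) - 1 := by
    rw [Nat.cast_add, Nat.cast_sub hp]
    ring
  rwa [h7] at h6

/-! ### The image of `y`. -/

/-- Comparing normal forms, `u - 1` annihilates the `y`-exponent of `φ x` and the `x`-exponent of `φ
y`; being prime to `p`, it forces both to vanish. -/
theorem apply_of_commute_alpha (h : Params p m n r) {u : (ZMod (p ^ m))ˣ}
    (hu : Subgroup.zpowers u = ⊤) {φ : MulAut (SplitMetacyclic p m n r)}
    (hφ : Commute φ (alpha h u)) :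
    ∃ (i : ℤ) (j : ℕ), φ (x p m n r) = x p m n r ^ i ∧ φ (y p m n r) = y p m n r ^ j := by
  have hU := coprime_val_sub_one h hu
  have hU1 := one_le_val h u
  have comm : ∀ g, φ (alpha h u g) = alpha h u (φ g) := fun g => DFunLike.congr_fun hφ g
  obtain ⟨i, l, hx⟩ := exists_eq_zpow_mul_pow h (φ (x p m n r))
  obtain ⟨k, j, hy⟩ := exists_eq_zpow_mul_pow h (φ (y p m n r))
  set U := (u : ZMod (p ^ m)).val
  refine ⟨i, j, ?_, ?_⟩
  · have h1 := comm (x p m n r)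
    rw [alpha_x, map_pow, hx, alpha_zpow_mul_pow, zpow_mul_pow_pow y_conj_x,
      zpow_mul_pow_eq_iff h] at h1
    have h2 := h1.2
    rw [← Int.cast_natCast, ← Int.cast_natCast l, intCast_zmod_eq_iff_dvd_sub] at h2
    have h3 : ((l * U : ℕ) : ℤ) - l = ((l * (U - 1) : ℕ) : ℤ) := by
      push_cast [Nat.cast_sub hU1]; ring
    rw [h3, Int.natCast_dvd_natCast] at h2
    have h4 : p ^ n ∣ l := (hU.pow_right n).symm.dvd_of_dvd_mul_right h2
    obtain ⟨q, rfl⟩ := h4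
    rw [hx, pow_mul, y_pow, one_pow, mul_one]
  · have h1 := comm (y p m n r)
    rw [alpha_y, hy, alpha_zpow_mul_pow, zpow_mul_pow_eq_iff h] at h1
    have h2 := dvd_sub_comm.1 h1.1
    have h3 : (U : ℤ) * k - k = ((U - 1 : ℕ) : ℤ) * k := by
      push_cast [Nat.cast_sub hU1]; ring
    rw [h3] at h2
    have h4 : ((p ^ m : ℕ) : ℤ) ∣ k :=
      (Nat.isCoprime_iff_coprime.2 (hU.pow_right m)).symm.dvd_of_dvd_mul_left h2
    rw [hy, zpow_eq_one_of_dvd x_pow h4, one_mul]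

theorem orderOf_unit_pow (h : Params p m n r) {u : (ZMod (p ^ m))ˣ}
    (hu : Subgroup.zpowers u = ⊤) : orderOf (u ^ ((p - 1) * p ^ (m - r - 1))) = p ^ r := by
  have hp0 : NeZero (p ^ m) := ⟨pow_ne_zero _ h.prime.ne_zero⟩
  have hr := h.r_lt
  have h1 : orderOf u = (p - 1) * p ^ (m - r - 1) * p ^ r := by
    rw [orderOf_eq_card_of_zpowers_eq_top hu, Nat.card_eq_fintype_card, ZMod.card_units_eq_totient,
      Nat.totient_prime_pow h.prime (by omega), mul_assoc, ← pow_add, mul_comm]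
    congr 2
    omega
  have h0 : (p - 1) * p ^ (m - r - 1) ≠ 0 :=
    mul_ne_zero (by have := h.prime.two_le; omega) (pow_ne_zero _ h.prime.ne_zero)
  rw [orderOf_pow_of_dvd h0 (h1 ▸ dvd_mul_right _ _), h1, Nat.mul_div_cancel_left _
    (Nat.pos_of_ne_zero h0)]

theorem exists_alphaTilde_pow_apply_x (h : Params p m n r) {u : (ZMod (p ^ m))ˣ}
    (hu : Subgroup.zpowers u = ⊤) {i : ℤ} (hi : (i : ZMod (p ^ m)) ^ p ^ r = 1) :
    ∃ a : ℕ, ((alpha h u ^ ((p - 1) * p ^ (m - r - 1))) ^ a) (x p m n r) = x p m n r ^ i := by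
  have hp0 : NeZero (p ^ m) := ⟨pow_ne_zero _ h.prime.ne_zero⟩
  have : IsCyclic (ZMod (p ^ m))ˣ := isCyclic_iff_exists_zpowers_eq_top.2 ⟨u, hu⟩
  have hv : Units.ofPowEqOne _ _ hi (pow_ne_zero _ h.prime.ne_zero) ∈
      Subgroup.zpowers (u ^ ((p - 1) * p ^ (m - r - 1))) := by
    apply IsCyclic.mem_zpowers_of_orderOf_dvd
    rw [orderOf_unit_pow h hu]
    exact orderOf_dvd_of_pow_eq_one (Units.pow_ofPowEqOne _ _)
  obtain ⟨a, ha⟩ := mem_powers_iff_mem_zpowers.2 hv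
  refine ⟨a, ?_⟩
  have h1 := congrArg Units.val ha
  simp only [Units.val_pow_eq_pow_val, Units.val_ofPowEqOne] at h1
  rw [← pow_mul, alpha_pow_x, x_zpow_eq_iff h, ← intCast_zmod_eq_iff_dvd_sub, pow_mul]
  push_cast
  rw [ZMod.natCast_zmod_val, h1]

/-- Modulo `p ^ n`, `1 + p ^ r` has order `p ^ (n - r)`, so its `p ^ (n - 2 * r)`-th power has order
`p ^ min r (n - r)`, also when `n < 2 * r` and the exponent truncates. The order of `j` divides both
`p ^ r` and `p ^ (n - r)`. -/
theorem exists_deltaTilde_pow_apply_y (h : Params p m n r) {j : ℕ}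
    (hj : ((p ^ r : ℕ) : ℤ) ∣ (j : ℤ) - 1) (hjr : (j : ZMod (p ^ n)) ^ p ^ r = 1) :
    ∃ d : ℕ, ((delta h ^ p ^ (n - 2 * r)) ^ d) (y p m n r) = y p m n r ^ j := by
  have hp0 : NeZero (p ^ n) := ⟨pow_ne_zero _ h.prime.ne_zero⟩
  have hr := h.r_le_n
  have hr1 := h.one_le_r
  have hp2 : p ≠ 2 := by rintro rfl; exact absurd h.odd (by decide)
  have : IsCyclic (ZMod (p ^ n))ˣ := ZMod.isCyclic_units_of_prime_pow p h.prime hp2 n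
  have hg : orderOf (1 + (p : ZMod (p ^ n)) ^ r) = p ^ (n - r) := by
    have := orderOf_one_add_prime_pow h.prime h.odd (s := r) (by omega) (n - r)
    rwa [Nat.sub_add_cancel hr] at this
  have hg1 : (1 + (p : ZMod (p ^ n)) ^ r) ^ p ^ (n - r) = 1 := by rw [← hg, pow_orderOf_eq_one]
  set g : (ZMod (p ^ n))ˣ := Units.ofPowEqOne _ _ hg1 (pow_ne_zero _ h.prime.ne_zero) with hgdef
  have hgval : (g : ZMod (p ^ n)) = 1 + (p : ZMod (p ^ n)) ^ r := Units.val_ofPowEqOne _ _ _ _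
  have hgord : orderOf g = p ^ (n - r) := by rw [← orderOf_units, hgval, hg]
  have hgord' : orderOf (g ^ p ^ (n - 2 * r)) = p ^ min r (n - r) := by
    have h1 : orderOf g = p ^ (n - 2 * r) * p ^ min r (n - r) := by
      rw [hgord, ← pow_add]; congr 1; omega
    rw [orderOf_pow_of_dvd (pow_ne_zero _ h.prime.ne_zero) (h1 ▸ dvd_mul_right _ _), h1,
      Nat.mul_div_cancel_left _ (Nat.pos_of_ne_zero (pow_ne_zero _ h.prime.ne_zero))]
  have hjn : (j : ZMod (p ^ n)) ^ p ^ (n - r) = 1 := by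
    have hpj : (p : ℤ) ∣ (j : ℤ) - 1 :=
      dvd_trans (by exact_mod_cast dvd_pow_self p (by omega : r ≠ 0)) hj
    have h1 := mul_dvd_mul (dvd_geom p (n - r) (j : ℤ) hpj) hj
    rw [geom_sum_mul, ← Nat.cast_mul, ← pow_add, Nat.sub_add_cancel hr,
      ← ZMod.intCast_zmod_eq_zero_iff_dvd] at h1
    push_cast at h1
    exact sub_eq_zero.1 h1
  have hv : Units.ofPowEqOne _ _ hjr (pow_ne_zero _ h.prime.ne_zero) ∈
      Subgroup.zpowers (g ^ p ^ (n - 2 * r)) := by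
    apply IsCyclic.mem_zpowers_of_orderOf_dvd
    rw [hgord', ← orderOf_units, Units.val_ofPowEqOne]
    rcases min_choice r (n - r) with hmin | hmin <;> rw [hmin]
    · exact orderOf_dvd_of_pow_eq_one hjr
    · exact orderOf_dvd_of_pow_eq_one hjn
  obtain ⟨d, hd⟩ := mem_powers_iff_mem_zpowers.2 hv
  refine ⟨d, ?_⟩
  have h1 := congrArg Units.val hd
  simp only [Units.val_pow_eq_pow_val, Units.val_ofPowEqOne, hgval] at h1
  rw [← pow_mul, delta_pow_y, y_pow_eq_iff h, pow_mul]
  push_cast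
  exact h1

theorem exists_eq_alphaTilde_pow_mul_deltaTilde_pow (h : Params p m n r) {u : (ZMod (p ^ m))ˣ}
    (hu : Subgroup.zpowers u = ⊤) {φ : MulAut (SplitMetacyclic p m n r)} {i : ℤ} {j : ℕ}
    (hx : φ (x p m n r) = x p m n r ^ i) (hy : φ (y p m n r) = y p m n r ^ j)
    (hφ : φ ^ p ^ r = 1) :
    ∃ a d : ℕ, φ = (alpha h u ^ ((p - 1) * p ^ (m - r - 1))) ^ a *
      (delta h ^ p ^ (n - 2 * r)) ^ d := by
  have hy' : φ (y p m n r) = x p m n r ^ (0 : ℤ) * y p m n r ^ j := by simpa using hy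
  have hi : (i : ZMod (p ^ m)) ^ p ^ r = 1 := by
    have h1 := pow_apply_x hx (p ^ r)
    rw [hφ, MulAut.one_apply] at h1
    nth_rewrite 1 [← zpow_one (x p m n r)] at h1
    rw [x_zpow_eq_iff h, ← intCast_zmod_eq_iff_dvd_sub] at h1
    push_cast at h1
    exact h1.symm
  have hj : (j : ZMod (p ^ n)) ^ p ^ r = 1 := by
    obtain ⟨k', h1⟩ := exists_pow_apply_y hx hy' (p ^ r)
    rw [hφ, MulAut.one_apply] at h1
    have h2 := congrArg (yExponent p m n r) h1
    rw [yExponent_zpow_mul_pow, yExponent_y] at h2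
    have h3 := Multiplicative.ofAdd.injective h2
    push_cast at h3
    exact h3.symm
  obtain ⟨a, ha⟩ := exists_alphaTilde_pow_apply_x h hu hi
  obtain ⟨d, hd⟩ := exists_deltaTilde_pow_apply_y h (dvd_sub_one_of_apply h hx hy') hj
  refine ⟨a, d, aut_ext ?_ ?_⟩
  · rw [MulAut.mul_apply, ← pow_mul (delta h), delta_pow_x, ha, hx]
  · rw [MulAut.mul_apply, hd, map_pow, ← pow_mul, alpha_pow_y, hy]

/-! ### The image of `x`. -/

theorem apply_x_mem_zpowers_of_commute_beta (h : Params p m n r)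
    {φ : MulAut (SplitMetacyclic p m n r)} (hβ : Commute φ (beta h)) :
    ∃ i : ℤ, φ (x p m n r) = x p m n r ^ i := by
  have hp0 : ((p ^ (m - n) : ℕ) : ℤ) ≠ 0 := by exact_mod_cast pow_ne_zero _ h.prime.ne_zero
  have comm : ∀ g, φ (beta h g) = beta h (φ g) := fun g => DFunLike.congr_fun hβ g
  obtain ⟨i, l, hx⟩ := exists_eq_zpow_mul_pow h (φ (x p m n r))
  obtain ⟨k, j, hy⟩ := exists_eq_zpow_mul_pow h (φ (y p m n r))
  suffices hl : p ^ n ∣ l by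
    obtain ⟨q, rfl⟩ := hl
    exact ⟨i, by rw [hx, pow_mul, y_pow, one_pow, mul_one]⟩
  rcases le_total n m with hnm | hmn
  -- `β` multiplies `x ^ i * y ^ l` by a power of `x` whose exponent has the valuation of `p ^ (m -
  -- n) * l`; `β` must fix `φ x`.
  · have h1 := comm (x p m n r)
    rw [beta_x, hx, beta_zpow_mul_pow, zpow_mul_pow_eq_iff h] at h1
    have h2 := dvd_sub_comm.1 h1.1
    rw [add_sub_cancel_left, show p ^ m = p ^ (m - n) * p ^ n by
      rw [← pow_add, Nat.sub_add_cancel hnm], Nat.cast_mul] at h2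
    exact (h.dvd_sum n l).1 (Int.dvd_of_mul_dvd_mul_left hp0 h2)
  -- Here `β y = x * y`, and `β` preserves `y`-exponents, so `φ x * φ y = β (φ y)` shows that `φ x`
  -- has `y`-exponent 0.
  · have h1 := congrArg (yExponent p m n r) (comm (y p m n r))
    rw [beta_y, hy, beta_zpow_mul_pow, Nat.sub_eq_zero_of_le hmn, pow_zero, pow_one, map_mul, hx,
      hy, map_mul, yExponent_zpow_mul_pow, yExponent_zpow_mul_pow, yExponent_zpow_mul_pow,
      mul_eq_right] at h1
    rw [← ZMod.natCast_eq_zero_iff]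
    exact Multiplicative.ofAdd.injective h1

/-- The relation `hα` gives `i ^ u = i` mod `p ^ m` and `j ^ u = j` mod `p ^ n`, while `hφ` makes
the orders of `i` and `j` powers of `p`, hence prime to `u - 1`. -/
theorem apply_of_alpha_conj_eq_pow (h : Params p m n r) {u : (ZMod (p ^ m))ˣ}
    (hu : Subgroup.zpowers u = ⊤) {φ : MulAut (SplitMetacyclic p m n r)} {i : ℤ}
    (hx : φ (x p m n r) = x p m n r ^ i) (hφ : φ ^ p ^ m = 1)
    (hα : alpha h u * φ = φ ^ (u : ZMod (p ^ m)).val * alpha h u) :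
    φ (x p m n r) = x p m n r ∧ ∃ k : ℤ, φ (y p m n r) = x p m n r ^ k * y p m n r := by
  have hp0 : NeZero (p ^ m) := ⟨pow_ne_zero _ h.prime.ne_zero⟩
  have hU := (coprime_val_sub_one h hu).pow_right m
  have hU1 := one_le_val h u
  have comm : ∀ g, alpha h u (φ g) = (φ ^ (u : ZMod (p ^ m)).val) (alpha h u g) :=
    fun g => DFunLike.congr_fun hα g
  obtain ⟨k, j, hy⟩ := exists_eq_zpow_mul_pow h (φ (y p m n r))
  have hi : (i : ZMod (p ^ m)) = 1 := by
    refine eq_one_of_pow_eq_self_of_pow_eq_one hU1 hU (NeZero.pos _) ?_ ?_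
    · have h1 := comm (x p m n r)
      rw [hx, alpha_x, map_zpow, map_pow, alpha_x, pow_apply_x hx, ← zpow_natCast, ← zpow_natCast,
        ← zpow_mul, ← zpow_mul, x_zpow_eq_iff h, ← intCast_zmod_eq_iff_dvd_sub] at h1
      push_cast at h1
      rw [ZMod.natCast_zmod_val, mul_comm, u.isUnit.mul_left_inj] at h1
      exact h1.symm
    · have h1 := pow_apply_x hx (p ^ m)
      rw [hφ, MulAut.one_apply] at h1
      nth_rewrite 1 [← zpow_one (x p m n r)] at h1
      rw [x_zpow_eq_iff h, ← intCast_zmod_eq_iff_dvd_sub] at h1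
      push_cast at h1
      exact h1.symm
  have hj : (j : ZMod (p ^ n)) = 1 := by
    refine eq_one_of_pow_eq_self_of_pow_eq_one hU1 hU (NeZero.pos _) ?_ ?_
    · obtain ⟨k', h2⟩ := exists_pow_apply_y hx hy (u : ZMod (p ^ m)).val
      have h1 := comm (y p m n r)
      rw [hy, alpha_zpow_mul_pow, alpha_y, h2, zpow_mul_pow_eq_iff h] at h1
      have h3 := h1.2
      push_cast at h3
      exact h3.symm
    · obtain ⟨k', h1⟩ := exists_pow_apply_y hx hy (p ^ m)
      rw [hφ, MulAut.one_apply] at h1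
      have h2 := congrArg (yExponent p m n r) h1
      rw [yExponent_zpow_mul_pow, yExponent_y] at h2
      have h3 := Multiplicative.ofAdd.injective h2
      push_cast at h3
      exact h3.symm
  refine ⟨?_, k, ?_⟩
  · rw [hx]
    nth_rewrite 2 [← zpow_one (x p m n r)]
    rw [x_zpow_eq_iff h, ← intCast_zmod_eq_iff_dvd_sub]
    simpa using hi
  · rw [hy]
    conv_rhs => rw [← pow_one (y p m n r)]
    rw [zpow_mul_pow_eq_iff h]
    simpa using hj

/-- The sum has valuation exactly `r`. -/
theorem Params.dvd_of_dvd_mul_sum (h : Params p m n r) {k : ℤ}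
    (hk : ((p ^ m : ℕ) : ℤ) ∣
      k * ∑ t ∈ Finset.range (p ^ r), ((1 + p ^ (m - r) : ℕ) : ℤ) ^ t) :
    ((p ^ (m - r) : ℕ) : ℤ) ∣ k := by
  have hr := h.r_lt
  have hpr : ((p ^ r : ℕ) : ℤ) ≠ 0 := by exact_mod_cast pow_ne_zero _ h.prime.ne_zero
  obtain ⟨w, hw⟩ := (h.dvd_sum r (p ^ r)).2 dvd_rfl
  have hpw : ¬ (p : ℤ) ∣ w := fun hd => by
    have h1 : ((p ^ (r + 1) : ℕ) : ℤ) ∣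
        ∑ t ∈ Finset.range (p ^ r), ((1 + p ^ (m - r) : ℕ) : ℤ) ^ t := by
      rw [hw, pow_succ, Nat.cast_mul]
      exact mul_dvd_mul_left _ hd
    rw [h.dvd_sum, Nat.pow_dvd_pow_iff_le_right h.prime.one_lt] at h1
    omega
  have hcop : IsCoprime ((p ^ (m - r) : ℕ) : ℤ) w := by
    push_cast
    exact ((Nat.prime_iff_prime_int.1 h.prime).coprime_iff_not_dvd.2 hpw).pow_left
  rw [hw, mul_left_comm, show p ^ m = p ^ r * p ^ (m - r) by
    rw [← pow_add, Nat.add_sub_cancel' hr.le], Nat.cast_mul] at hk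
  exact hcop.dvd_of_dvd_mul_right (Int.dvd_of_mul_dvd_mul_left hpr hk)

theorem exists_eq_betaTilde_pow (h : Params p m n r) {φ : MulAut (SplitMetacyclic p m n r)}
    {k : ℤ} (hx : φ (x p m n r) = x p m n r) (hy : φ (y p m n r) = x p m n r ^ k * y p m n r)
    (hδ : Commute φ (delta h)) : ∃ b : ℕ, φ = (beta h ^ p ^ (min m n - r)) ^ b := by
  have hr := h.r_lt
  have hrn := h.r_le_n
  have hk : ((p ^ (m - r) : ℕ) : ℤ) ∣ k := by
    have h1 : φ (delta h (y p m n r)) = delta h (φ (y p m n r)) := DFunLike.congr_fun hδ _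
    have h2 := delta_zpow_mul_pow h k 1
    have h3 := zpow_mul_pow_pow (y_conj_x (p := p) (m := m) (n := n) (r := r)) k 1 (1 + p ^ r)
    simp only [pow_one, one_mul, mul_one] at h2 h3
    -- The sum over `p ^ r + 1` terms is `c` times the sum over `p ^ r` terms, plus 1; the 1 cancels
    -- and `c` is prime to `p`.
    rw [delta_y, map_pow, hy, h2, h3, zpow_mul_pow_eq_iff h, add_comm 1 (p ^ r),
      geom_sum_succ] at h1
    refine h.dvd_of_dvd_mul_sum ?_
    have h4 : IsCoprime ((p ^ m : ℕ) : ℤ) ((1 + p ^ (m - r) : ℕ) : ℤ) := by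
      have h5 : IsCoprime ((p : ℕ) : ℤ) ((1 + p ^ (m - r) : ℕ) : ℤ) := by
        have h6 := h.dvd_c_sub_one 1
        rw [pow_one] at h6
        obtain ⟨q, hq⟩ := h6
        exact ⟨-q, 1, by linear_combination hq⟩
      push_cast at h5 ⊢
      exact h5.pow_left
    refine h4.dvd_of_dvd_mul_left ?_
    have h5 := h1.1
    rwa [mul_add, mul_one, add_sub_cancel_right, mul_left_comm] at h5
  have hpm : ((p ^ m : ℕ) : ℤ) ≠ 0 := by exact_mod_cast pow_ne_zero _ h.prime.ne_zero
  obtain ⟨k', hk'⟩ : ∃ k' : ℕ, k % ((p ^ m : ℕ) : ℤ) = k' :=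
    Int.eq_ofNat_of_zero_le (Int.emod_nonneg k hpm)
  have hkk' : x p m n r ^ k = x p m n r ^ k' := by
    rw [← zpow_natCast, x_zpow_eq_iff h, ← hk']
    exact Int.dvd_self_sub_emod
  have hdvd : p ^ (m - r) ∣ k' := by
    rw [← Int.natCast_dvd_natCast, ← hk', Int.emod_def]
    exact dvd_sub hk (Dvd.dvd.mul_right (by exact_mod_cast pow_dvd_pow p (Nat.sub_le m r)) _)
  obtain ⟨b, rfl⟩ := hdvd
  refine ⟨b, aut_ext ?_ ?_⟩
  · rw [← pow_mul, beta_pow_x, hx]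
  · rw [← pow_mul, beta_pow_y, hy, hkk', ← mul_assoc, ← pow_add]
    -- With truncated subtraction, `(m - n) + (min m n - r) = m - r`.
    congr 4
    omega

end SplitMetacyclic

/-! ### Antihomomorphisms, equivariance and the conclusion. -/

namespace IsAntihom

variable {G K : Type*} [Group G] [Group K] {Γ : G → K}

/-- The homomorphism `σ ↦ (Γ σ)⁻¹` of an antihomomorphism `Γ`. -/
def invHom (hΓ : IsAntihom Γ) : G →* K :=
  MonoidHom.mk' (fun σ => (Γ σ)⁻¹) fun σ τ => by rw [hΓ, mul_inv_rev]

theorem map_pow (hΓ : IsAntihom Γ) (σ : G) (N : ℕ) : Γ (σ ^ N) = Γ σ ^ N := by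
  have := _root_.map_pow hΓ.invHom σ N
  simpa [invHom] using this

theorem map_one (hΓ : IsAntihom Γ) : Γ 1 = 1 := by
  simpa using hΓ.map_pow 1 0

end IsAntihom

theorem IsAutEquivariant.commute {G : Type*} [Group G] {Γ : G → MulAut G}
    (hΓ : IsAutEquivariant Γ) {φ : MulAut G} {σ : G} (hσ : φ σ = σ) : Commute (Γ σ) φ := by
  have := hΓ φ σ
  rw [hσ, eq_mul_inv_iff_mul_eq] at this
  exact this

open SplitMetacyclic in
theorem SplitMetacyclic.antihom_ext {p m n r : ℕ} {K : Type*} [Group K]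
    {Γ Γ' : SplitMetacyclic p m n r → K} (hΓ : IsAntihom Γ) (hΓ' : IsAntihom Γ')
    (hx : Γ (x p m n r) = Γ' (x p m n r)) (hy : Γ (y p m n r) = Γ' (y p m n r)) : Γ = Γ' := by
  have h1 : hΓ.invHom = hΓ'.invHom :=
    hom_ext (by simp [IsAntihom.invHom, hx]) (by simp [IsAntihom.invHom, hy])
  funext σ
  have := DFunLike.congr_fun h1 σ
  simpa [IsAntihom.invHom] using this

open SplitMetacyclic in
theorem proposition2p4 {p m n r : ℕ} (h : Params p m n r)
    (u : (ZMod (p ^ m))ˣ) (hu : Subgroup.zpowers u = ⊤)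
    (Γ : SplitMetacyclic p m n r → MulAut (SplitMetacyclic p m n r))
    (hanti : IsAntihom Γ) (hequiv : IsAutEquivariant Γ) :
    -- the product of the two cyclic subgroups is an internal direct product
    (Commute (alpha h u ^ ((p - 1) * p ^ (m - r - 1))) (delta h ^ p ^ (n - 2 * r)) ∧
      Disjoint (Subgroup.zpowers (alpha h u ^ ((p - 1) * p ^ (m - r - 1))))
        (Subgroup.zpowers (delta h ^ p ^ (n - 2 * r)))) ∧
    Γ (y p m n r) ∈
      Subgroup.zpowers (alpha h u ^ ((p - 1) * p ^ (m - r - 1))) ⊔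
        Subgroup.zpowers (delta h ^ p ^ (n - 2 * r)) ∧
    Γ (x p m n r) ∈ Subgroup.zpowers (beta h ^ p ^ (min m n - r)) ∧
    ∃ a b d : ℤ, IsGammaABD h u a b d Γ ∧ ∀ Γ', IsGammaABD h u a b d Γ' → Γ' = Γ := by
  obtain ⟨a, d, hΓy⟩ : ∃ a d : ℕ, Γ (y p m n r) =
      (alpha h u ^ ((p - 1) * p ^ (m - r - 1))) ^ a * (delta h ^ p ^ (n - 2 * r)) ^ d := by
    obtain ⟨i, j, hx, hy⟩ := apply_of_commute_alpha h hu (hequiv.commute (alpha_y h u))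
    refine exists_eq_alphaTilde_pow_mul_deltaTilde_pow h hu hx hy ?_
    have hδ : Commute (Γ (y p m n r)) (delta h) := by
      refine aut_ext ?_ ?_
      · rw [MulAut.mul_apply, MulAut.mul_apply, delta_x, hx, map_zpow, delta_x]
      · rw [MulAut.mul_apply, MulAut.mul_apply, delta_y, hy, map_pow, map_pow, hy, delta_y,
          ← pow_mul, ← pow_mul, mul_comm]
    -- `Γ y ^ (1 + p ^ r) = Γ (δ y) = δ * Γ y * δ⁻¹ = Γ y`.
    have h1 := hequiv (delta h) (y p m n r)
    rwa [delta_y, hanti.map_pow, ← hδ.eq, mul_inv_cancel_right, pow_add, pow_one,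
      mul_eq_left] at h1
  obtain ⟨b, hΓx⟩ : ∃ b : ℕ, Γ (x p m n r) = (beta h ^ p ^ (min m n - r)) ^ b := by
    obtain ⟨i, hi⟩ := apply_x_mem_zpowers_of_commute_beta h (hequiv.commute (beta_x h))
    obtain ⟨hx, k, hy⟩ := apply_of_alpha_conj_eq_pow h hu hi
      (by rw [← hanti.map_pow, x_pow, hanti.map_one])
      (by rw [← hanti.map_pow, ← alpha_x h u, hequiv, inv_mul_cancel_right])
    exact exists_eq_betaTilde_pow h hx hy (hequiv.commute (delta_x h))
  have hG : IsGammaABD h u a b d Γ :=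
    ⟨hanti, by rw [hΓx, zpow_natCast, betaTilde],
      by rw [hΓy, zpow_natCast, zpow_natCast, alphaTilde, deltaTilde]⟩
  refine ⟨⟨(commute_alpha_delta h u).pow_pow _ _, (disjoint_zpowers_alpha_delta h u).mono ?_ ?_⟩,
    ?_, ?_, a, b, d, hG, fun Γ' hΓ' => antihom_ext hΓ'.antihom hanti ?_ ?_⟩
  · exact Subgroup.zpowers_le.2 (Subgroup.npow_mem_zpowers _ _)
  · exact Subgroup.zpowers_le.2 (Subgroup.npow_mem_zpowers _ _)
  · rw [hΓy]
    exact Subgroup.mul_mem_sup (Subgroup.npow_mem_zpowers _ _) (Subgroup.npow_mem_zpowers _ _)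
  · rw [hΓx]
    exact Subgroup.npow_mem_zpowers _ _
  · rw [hΓ'.map_x, hG.map_x]
  · rw [hΓ'.map_y, hG.map_y]
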